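/- **Setting.** Consider the two-stage stochastic integer program $$(\star)\quad \min\ \sum_{j\in\mathcal J}\sum_{k\in\mathcal K_j}c_kx_k+\sum_{s\in\mathcal S}\sum_{j\in\mathcal J}\pi_s\sum_{a\in\mathcal A_{sj}}g_ay_a$$ subject to $\boldsymbol A\boldsymbol x\ge\boldsymbol b$, $\boldsymbol x\in\mathcal X$, and, for all $s\in\mathcal S$, $j\in\mathcal J$, $$\sum_{m:(n,m)\in\mathcal A_{sj}}y_{(n,m)}-\sum_{m:(m,n)\in\mathcal A_{sj}}y_{(m,n)}=\sum_{k\in\mathcal K_j}b_{nsk}x_k\ (n\in\mathcal N_{sj}),\qquad \sum_{a\in\mathcal A_{sj}}\boldsymbol f_{asj}y_a\ge\boldsymbol h_{sj},\qquad y_a\in\mathcal Y_a\ (a\in\mathcal A_{sj}).$$ Here $\mathcal S$ is a finite set of scenarios with probabilities $\pi_s$, the finite sets $\mathcal K_j$, $j\in\mathcal J$, partition the first-stage indices, $(\mathcal N_{sj},\mathcal A_{sj})$ are finite directed networks, and $\mathcal Y_a\subseteq[0,\infty)$ are the (discrete) domains of the second-stage variables. Let $\varphi_{sj}(\boldsymbol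 x)$ be the minimum of $\sum_{a\in\mathcal A_{sj}}g_ay_a$ under the constraints of block $(s,j)$. Let its relaxation be obtained by replacing $y_a\in\mathcal Y_a$ with $y_a\ge0$, and let $\mathcal P_{sj}$ be the dual polyhedron of that relaxation: all $(\boldsymbol\psi,\boldsymbol\gamma)$ with $\boldsymbol\gamma\ge\boldsymbol 0$ and $\psi_m-\psi_n+\boldsymbol\gamma^\top\boldsymbol f_{(m,n)sj}\le g_{(m,n)}$ for all $(m,n)\in\mathcal A_{sj}$. For all first-stage feasible $\boldsymbol x$ (i.e. $\boldsymbol x\in\mathcal X$, $\boldsymbol A\boldsymbol x\ge\boldsymbol b$), assume that the minimum $\varphi_{sj}(\boldsymbol x)$ is attained whenever its problem is feasible, and that the relaxation is not unbounded. Let $\underline\varPhi_{sj}$ be numbers with $\underline\varPhi_{sj}\le\varphi_{sj}(\boldsymbol x)$ for all first-stage feasible $\boldsymbol x$. **The DD&ILS algorithm**, with a tolerance $\varepsilon\ge0$, maintains arc sets $\mathcal A'_{sj}\subseteq\mathcal A_{sj}$, finite sets $\mathcal U_{sj}\subseteq\mathcal P_{sj}$ and a set $\mathcal W$ of visited first-stage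 vectors. Initially $\mathcal W=\emptyset$, the sets $\mathcal A'_{sj}$ are arbitrary, and $\mathcal U_{sj}$ are any finite subsets of $\mathcal P_{sj}$ for which the master problem below is not unbounded. It repeats: 1. Solve the master problem: minimize $\boldsymbol c^\top\boldsymbol x+\sum_{s,j}\pi_s\theta_{sj}$ over $\boldsymbol x\in\mathcal X$ with $\boldsymbol A\boldsymbol x\ge\boldsymbol b$ and $\theta_{sj}\in\mathbb R$, subject to the Benders cuts $\theta_{sj}\ge\sum_{n}\sum_{k\in\mathcal K_j}b_{nsk}x_k\psi_n+\boldsymbol h_{sj}^\top\boldsymbol\gamma$ for $(\boldsymbol\psi,\boldsymbol\gamma)\in\mathcal U_{sj}$ and the integer L-shaped cuts $$\theta_{sj}\ge\underline\varPhi_{sj}+(\varphi_{sj}(\boldsymbol w)-\underline\varPhi_{sj})\Big(1-\sum_{k\in\mathcal K_j:w_k=1}(1-x_k)-\sum_{k\in\mathcal K_j:w_k=0}x_k\Big),\qquad \boldsymbol w\in\mathcal W .$$ If it is infeasible, stop and report infeasibility. Otherwise let $(\widehat{\boldsymbol x},\widehat{\boldsymbol\theta})$ be an optimal solution. 2. Solve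 the relaxations at $\widehat{\boldsymbol x}$ by column generation: solve each of them with the arcs in $\mathcal A'_{sj}$ only, obtain an optimal dual solution (or, if it is infeasible, a ray along which its dual is unbounded), and price all arcs in $\mathcal A_{sj}$. In each block, add one or more arcs of negative reduced cost (respectively, arcs whose dual constraint is violated by the ray) to $\mathcal A'_{sj}$, if there are any. Repeat until every block has an optimal dual solution for which no arc has negative reduced cost. If the Benders cuts of these dual solutions are not all satisfied by $(\widehat{\boldsymbol x},\widehat{\boldsymbol\theta})$, add the dual solutions to all the $\mathcal U_{sj}$ and go to 1. 3. Solve the integer second-stage problems at $\widehat{\boldsymbol x}$. If $\sum_{s,j}\pi_s(\varphi_{sj}(\widehat{\boldsymbol x})-\widehat\theta_{sj})\le\varepsilon$, stop and return $\widehat{\boldsymbol x}$ with optimal second-stage solutions. Otherwise add $\widehat{\boldsymbol x}$ to $\mathcal W$ and go to 1. **Theorem 2.** Assume that the first-stage variables are binary, i.e. $\mathcal X=\{0,1\}^{n_Z}$, where $n_Z$ is the number of first-stage variables, and that the problem has relatively complete recourse: for every first-stage feasible $\boldsymbol x$ all second-stage problems (with $y_a\in\mathcal Y_a$) are feasible.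 Then an admissible initialization exists and, for all admissible initializations and all choices among optimal solutions, dual solutions and priced arcs, the DD&ILS algorithm is never stuck and stops after finitely many steps (bounded independently of these choices and of $\varepsilon$). It reports infeasibility only if $(\star)$ is infeasible; otherwise it returns a feasible solution of $(\star)$ whose objective is within $\varepsilon$ of the optimal value. There is $\varepsilon_0>0$ such that for every $\varepsilon\in[0,\varepsilon_0)$, in particular for $\varepsilon=0$, the returned solution is an optimal solution of $(\star)$. -/

import Mathlib

/-! # A two-stage stochastic integer program with network-structured recourse -/

/-- The data of one second-stage block (one scenario `s`, one element `j` of the partition):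
a finite directed multigraph, whose arcs carry costs `g`, side-constraint coefficients `f` with
right-hand sides `h`, and domains `Y` of admissible (nonnegative, typically discrete) values. -/
structure Block where
  Node : Type
  Arc : Type
  Row : Type
  [fintypeNode : Fintype Node]
  [fintypeArc : Fintype Arc]
  [fintypeRow : Fintype Row]
  tail : Arc → Node
  head : Arc → Node
  g : Arc → ℝ
  f : Arc → Row → ℝ
  h : Row → ℝ
  Y : Arc → Set ℝ
  Y_nonneg : ∀ a, ∀ v ∈ Y a, 0 ≤ v

attribute [instance] Block.fintypeNode Block.fintypeArc Block.fintypeRow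

namespace Block

variable (B : Block)

/-- Second-stage cost `∑ₐ gₐ yₐ`. -/
def cost (y : B.Arc → ℝ) : ℝ := ∑ a, B.g a * y a

open Classical in
/-- The linear constraints of the block: flow balance with net supplies `d`, and side
constraints. -/
def Linear (d : B.Node → ℝ) (y : B.Arc → ℝ) : Prop :=
  (∀ n, (∑ a with B.tail a = n, y a) - (∑ a with B.head a = n, y a) = d n) ∧
    ∀ i, B.h i ≤ ∑ a, B.f a i * y a

/-- Feasibility for the integer second-stage problem. -/
def IntFeasible (d : B.Node → ℝ) (y : B.Arc → ℝ) : Prop :=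
  B.Linear d y ∧ ∀ a, y a ∈ B.Y a

/-- `y` is an optimal solution of the integer second-stage problem. -/
def IntOptimal (d : B.Node → ℝ) (y : B.Arc → ℝ) : Prop :=
  B.IntFeasible d y ∧ ∀ y', B.IntFeasible d y' → B.cost y ≤ B.cost y'

/-- Feasibility for the continuous relaxation `y ≥ 0` restricted to the arcs of `A'`
(variables of the other arcs are absent, i.e. zero). The unrestricted relaxation is
`A' = Set.univ`. -/
def RelaxFeasible (A' : Set B.Arc) (d : B.Node → ℝ) (y : B.Arc → ℝ) : Prop :=
  B.Linear d y ∧ (∀ a, 0 ≤ y a) ∧ ∀ a, a ∉ A' → y a = 0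

/-- Dual vectors `(ψ, γ)`: multipliers of flow balance and of the side constraints. -/
abbrev Dual : Type := (B.Node → ℝ) × (B.Row → ℝ)

/-- `ψ_m - ψ_n + γᵀ f_a` for the arc `a = (m, n)`. -/
def dualLhs (p : B.Dual) (a : B.Arc) : ℝ :=
  p.1 (B.tail a) - p.1 (B.head a) + ∑ i, p.2 i * B.f a i

/-- Dual objective for net supplies `d`. -/
def dualObj (d : B.Node → ℝ) (p : B.Dual) : ℝ :=
  (∑ n, d n * p.1 n) + ∑ i, B.h i * p.2 i

/-- The dual polyhedron of the relaxation restricted to the arcs of `A'`. -/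
def dualPoly (A' : Set B.Arc) : Set B.Dual :=
  {p | (∀ i, 0 ≤ p.2 i) ∧ ∀ a ∈ A', B.dualLhs p a ≤ B.g a}

/-- `p` is an optimal dual solution of the relaxation restricted to the arcs of `A'`. -/
def DualOptimal (A' : Set B.Arc) (d : B.Node → ℝ) (p : B.Dual) : Prop :=
  p ∈ B.dualPoly A' ∧ ∀ q ∈ B.dualPoly A', B.dualObj d q ≤ B.dualObj d p

/-- `r` is a ray along which the dual of the relaxation restricted to `A'` is unbounded, i.e. the
certificate returned when that relaxation is infeasible. -/
def DualRay (A' : Set B.Arc) (d : B.Node → ℝ) (r : B.Dual) : Prop :=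
  (∀ i, 0 ≤ r.2 i) ∧ (∀ a ∈ A', B.dualLhs r a ≤ 0) ∧ 0 < B.dualObj d r

/-- Reduced cost of an arc. -/
def redCost (p : B.Dual) (a : B.Arc) : ℝ := B.g a - B.dualLhs p a

/-- One round "solve the restricted relaxation, then price" in this block; `new` is the set of arcs
found by the pricing problem. If the restricted relaxation is feasible it returns an optimal dual
solution, and the pricing problem returns arcs of negative reduced cost, at least one if there is
any. If it is infeasible, the same is done with a dual ray (for which the cost `g` is dropped). -/
def Prices (A' : Set B.Arc) (d : B.Node → ℝ) (new : Set B.Arc) : Prop :=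
  (∃ p, B.DualOptimal A' d p ∧ (∀ a ∈ new, B.redCost p a < 0) ∧
      (new = ∅ → ∀ a, 0 ≤ B.redCost p a)) ∨
  (∃ r, B.DualRay A' d r ∧ (∀ a ∈ new, 0 < B.dualLhs r a) ∧
      (new = ∅ → ∀ a, B.dualLhs r a ≤ 0))

end Block

/-- The data of the two-stage problem: scenarios `S` with probabilities `prob`, first-stage
variables indexed by `K`, which is partitioned into the cells `{k | part k = j}`, `j : J`,
first-stage constraints `A x ≥ rhs` (rows `M`), `x ∈ X`, and one second-stage block for each
`s : S`, `j : J`, linked to `x` through the coefficients `b`. -/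
structure TwoStage (S J K M : Type*) [Fintype S] [Fintype J] [Fintype K] [Fintype M] where
  prob : S → ℝ
  prob_nonneg : ∀ s, 0 ≤ prob s
  prob_sum : ∑ s, prob s = 1
  part : K → J
  c : K → ℝ
  A : Matrix M K ℝ
  rhs : M → ℝ
  X : Set (K → ℝ)
  blk : S → J → Block
  b : ∀ s j, (blk s j).Node → K → ℝ

namespace TwoStage

variable {S J K M : Type*} [Fintype S] [Fintype J] [Fintype K] [Fintype M]
variable (P : TwoStage S J K M)

open Classical in
/-- The cell `K_j` of the partition of the first-stage indices. -/
noncomputable def cell (j : J) : Finset K := {k | P.part k = j}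

/-- Right-hand side `∑_{k ∈ K_j} b_{nsk} x_k` of the flow balance constraints. -/
noncomputable def supply (s : S) (j : J) (x : K → ℝ) : (P.blk s j).Node → ℝ :=
  fun n => ∑ k ∈ P.cell j, P.b s j n k * x k

/-- First-stage feasibility: `x ∈ X` and `A x ≥ rhs`. -/
def FirstFeasible (x : K → ℝ) : Prop := x ∈ P.X ∧ ∀ i, P.rhs i ≤ P.A.mulVec x i

/-- A second-stage decision: one vector for each scenario and partition element. -/
abbrev Second : Type _ := ∀ s j, (P.blk s j).Arc → ℝ

/-- Feasibility for the two-stage problem. -/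
def Feasible (x : K → ℝ) (y : P.Second) : Prop :=
  P.FirstFeasible x ∧ ∀ s j, (P.blk s j).IntFeasible (P.supply s j x) (y s j)

/-- Objective of the two-stage problem. -/
def totalCost (x : K → ℝ) (y : P.Second) : ℝ :=
  (∑ k, P.c k * x k) + ∑ s, ∑ j, P.prob s * (P.blk s j).cost (y s j)

/-- Optimality for the two-stage problem. -/
def Optimal (x : K → ℝ) (y : P.Second) : Prop :=
  P.Feasible x y ∧ ∀ x' y', P.Feasible x' y' → P.totalCost x y ≤ P.totalCost x' y'

/-- The integer second-stage cost `φ_{sj}(x)`. -/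
noncomputable def phi (s : S) (j : J) (x : K → ℝ) : ℝ :=
  sInf ((P.blk s j).cost '' {y | (P.blk s j).IntFeasible (P.supply s j x) y})

/-- Relatively complete recourse: every feasible first-stage decision admits a feasible
second-stage decision. -/
def RelativelyCompleteRecourse : Prop :=
  ∀ x, P.FirstFeasible x → ∀ s j, ∃ y, (P.blk s j).IntFeasible (P.supply s j x) y

/-- The minimum defining `φ_{sj}(x)` is attained whenever the problem is feasible. -/
def SecondStageAttained : Prop :=
  ∀ x, P.FirstFeasible x → ∀ s j, (∃ y, (P.blk s j).IntFeasible (P.supply s j x) y) →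
    ∃ y, (P.blk s j).IntOptimal (P.supply s j x) y

/-- The continuous relaxations of the second-stage problems are not unbounded. -/
def RelaxationBounded : Prop :=
  ∀ x, P.FirstFeasible x → ∀ s j,
    BddBelow ((P.blk s j).cost '' {y | (P.blk s j).RelaxFeasible Set.univ (P.supply s j x) y})

/-! ## The algorithm -/

/-- `Φ` is a global lower bound on the second-stage costs. -/
def IsLowerBound (Φ : S → J → ℝ) : Prop :=
  ∀ x, P.FirstFeasible x → ∀ s j, Φ s j ≤ P.phi s j x

/-- Restricted arc sets, one for each block. -/
abbrev ArcSets : Type _ := ∀ s j, Set (P.blk s j).Arc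

/-- Dual vectors that index the Benders optimality cuts of each block. -/
abbrev BendersCuts : Type _ := ∀ s j, Set (P.blk s j).Dual

/-- The number of indices in `K_j` at which the binary vectors `w` and `x` differ, in the linear
form used by the integer L-shaped cuts. -/
noncomputable def dist (j : J) (w x : K → ℝ) : ℝ :=
  (∑ k ∈ P.cell j with w k = 1, (1 - x k)) + ∑ k ∈ P.cell j with w k = 0, x k

/-- Feasibility for the master problem with Benders optimality cuts `U` and integer L-shaped cuts
at the first-stage vectors `W`. -/
def MasterFeasible (Φ : S → J → ℝ) (U : P.BendersCuts) (W : Set (K → ℝ))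
    (x : K → ℝ) (θ : S → J → ℝ) : Prop :=
  P.FirstFeasible x ∧
  (∀ s j, ∀ p ∈ U s j, (P.blk s j).dualObj (P.supply s j x) p ≤ θ s j) ∧
  (∀ s j, ∀ w ∈ W, Φ s j + (P.phi s j w - Φ s j) * (1 - P.dist j w x) ≤ θ s j)

/-- Objective of the master problem. -/
def masterCost (x : K → ℝ) (θ : S → J → ℝ) : ℝ :=
  (∑ k, P.c k * x k) + ∑ s, ∑ j, P.prob s * θ s j

/-- Optimality for the master problem. -/
def MasterOptimal (Φ : S → J → ℝ) (U : P.BendersCuts) (W : Set (K → ℝ))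
    (x : K → ℝ) (θ : S → J → ℝ) : Prop :=
  P.MasterFeasible Φ U W x θ ∧
    ∀ x' θ', P.MasterFeasible Φ U W x' θ' → P.masterCost x θ ≤ P.masterCost x' θ'

/-- Integrality gap of a master solution `(x, θ)`. -/
noncomputable def gap (x : K → ℝ) (θ : S → J → ℝ) : ℝ :=
  ((∑ k, P.c k * x k) + ∑ s, ∑ j, P.prob s * P.phi s j x) - P.masterCost x θ

/-- States of the algorithm.
* `master A' U W`: about to solve the master problem;
* `sub A' U W x θ`: the master problem returned `(x, θ)`; about to solve the restricted Benders
  subproblem and the pricing problem;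
* `second A' U W x θ`: no Benders cut is violated; about to solve the integer second-stage problem;
* `infeasible`: stopped, the problem is reported infeasible;
* `done x y`: stopped, `(x, y)` is returned. -/
inductive State where
  | master (A' : P.ArcSets) (U : P.BendersCuts) (W : Set (K → ℝ))
  | sub (A' : P.ArcSets) (U : P.BendersCuts) (W : Set (K → ℝ)) (x : K → ℝ) (θ : S → J → ℝ)
  | second (A' : P.ArcSets) (U : P.BendersCuts) (W : Set (K → ℝ)) (x : K → ℝ) (θ : S → J → ℝ)
  | infeasible
  | done (x : K → ℝ) (y : P.Second)

/-- The algorithm has stopped. -/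
def State.Stopped {P : TwoStage S J K M} : P.State → Prop
  | .infeasible => True
  | .done _ _ => True
  | _ => False

/-- Initial states: any restricted arc sets, no integer L-shaped cut, and finitely many Benders
cuts (at dual feasible points) for which the master problem is not unbounded. -/
def Initial (Φ : S → J → ℝ) (σ : P.State) : Prop :=
  ∃ (A' : P.ArcSets) (U : P.BendersCuts), σ = .master A' U ∅ ∧
    (∀ s j, (U s j).Finite ∧ U s j ⊆ (P.blk s j).dualPoly Set.univ) ∧
    BddBelow {v | ∃ x θ, P.MasterFeasible Φ U ∅ x θ ∧ v = P.masterCost x θ}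

/-- One step of double decomposition with multi-cut integer L-shaped cuts, with tolerance `ε` for
the integrality gap. All choices among optimal solutions, dual solutions and priced-out arcs are
left open. -/
inductive Step (Φ : S → J → ℝ) (ε : ℝ) : P.State → P.State → Prop
  /-- The master problem is infeasible: stop. -/
  | masterInfeasible {A' : P.ArcSets} {U : P.BendersCuts} {W : Set (K → ℝ)}
      (hinf : ∀ x θ, ¬ P.MasterFeasible Φ U W x θ) :
      Step Φ ε (.master A' U W) .infeasible
  /-- The master problem returns an optimal solution. -/
  | masterSolve {A' : P.ArcSets} {U : P.BendersCuts} {W : Set (K → ℝ)}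
      {x : K → ℝ} {θ : S → J → ℝ} (hopt : P.MasterOptimal Φ U W x θ) :
      Step Φ ε (.master A' U W) (.sub A' U W x θ)
  /-- Column generation: the pricing problem finds new arcs in at least one block. -/
  | price {A' : P.ArcSets} {U : P.BendersCuts} {W : Set (K → ℝ)}
      {x : K → ℝ} {θ : S → J → ℝ} {new : P.ArcSets}
      (hprice : ∀ s j, (P.blk s j).Prices (A' s j) (P.supply s j x) (new s j))
      (hnew : ∃ s j, (new s j).Nonempty) :
      Step Φ ε (.sub A' U W x θ) (.sub (fun s j => A' s j ∪ new s j) U W x θ)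
  /-- Column generation has converged, and some Benders optimality cut given by the optimal dual
  solutions is violated: add these cuts for all blocks, and return to the master problem. -/
  | benders {A' : P.ArcSets} {U : P.BendersCuts} {W : Set (K → ℝ)}
      {x : K → ℝ} {θ : S → J → ℝ} {p : ∀ s j, (P.blk s j).Dual}
      (hp : ∀ s j, (P.blk s j).DualOptimal (A' s j) (P.supply s j x) (p s j) ∧
        ∀ a, 0 ≤ (P.blk s j).redCost (p s j) a)
      (hviol : ∃ s j, θ s j < (P.blk s j).dualObj (P.supply s j x) (p s j)) :
      Step Φ ε (.sub A' U W x θ) (.master A' (fun s j => U s j ∪ {p s j}) W)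
  /-- Column generation has converged, and no Benders cut is violated. -/
  | bendersConverged {A' : P.ArcSets} {U : P.BendersCuts} {W : Set (K → ℝ)}
      {x : K → ℝ} {θ : S → J → ℝ} {p : ∀ s j, (P.blk s j).Dual}
      (hp : ∀ s j, (P.blk s j).DualOptimal (A' s j) (P.supply s j x) (p s j) ∧
        ∀ a, 0 ≤ (P.blk s j).redCost (p s j) a)
      (hok : ∀ s j, (P.blk s j).dualObj (P.supply s j x) (p s j) ≤ θ s j) :
      Step Φ ε (.sub A' U W x θ) (.second A' U W x θ)
  /-- The integer second-stage problem is solved and the gap is within the tolerance: return. -/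
  | finish {A' : P.ArcSets} {U : P.BendersCuts} {W : Set (K → ℝ)}
      {x : K → ℝ} {θ : S → J → ℝ} {y : P.Second}
      (hy : ∀ s j, (P.blk s j).IntOptimal (P.supply s j x) (y s j))
      (hgap : P.gap x θ ≤ ε) :
      Step Φ ε (.second A' U W x θ) (.done x y)
  /-- The gap exceeds the tolerance: add the integer L-shaped cuts at `x` for all blocks, and
  return to the master problem. -/
  | lShaped {A' : P.ArcSets} {U : P.BendersCuts} {W : Set (K → ℝ)}
      {x : K → ℝ} {θ : S → J → ℝ} (hgap : ε < P.gap x θ) :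
      Step Φ ε (.second A' U W x θ) (.master A' U (W ∪ {x}))

/-- `σ 0, …, σ n` is an execution of `n` steps of the algorithm. -/
def IsRun (Φ : S → J → ℝ) (ε : ℝ) (σ : ℕ → P.State) (n : ℕ) : Prop :=
  P.Initial Φ (σ 0) ∧ ∀ i < n, P.Step Φ ε (σ i) (σ (i + 1))

end TwoStage

/-! Correctness rests on the validity of all cuts. Benders cuts are valid by weak duality
(`dualObj_le_phi`). An integer L-shaped cut is tight where `x` agrees with `w` on the cell;
elsewhere two binary vectors have distance at least one, so the cut drops to `Φ` or below
(`lShaped_le_phi`). Hence every first-stage feasible `x`, paired with its true second-stage costs,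
stays feasible for the master problem (`masterFeasible_phi`). The master value is therefore a lower
bound, and a gap of at most `ε` certifies the returned point.

Termination rests on finiteness of the binary first stage and of the arc sets. A violated Benders
cut at `x` means that no optimal dual solutions for `x` were stored in all blocks, and they are
stored from then on. A positive gap at `x` means that `x` was not visited. Each pricing round adds a
new arc, and arcs are never removed. `Step.potential_lt` combines these three counts into one
natural number that decreases at each step, whatever choices are made.

The algorithm is never stuck because each subproblem has the solution or certificate asked for. For
the linear programs this is duality with attainment, derived from `farkas`; for the master problem
it is a finite minimum over `x` of explicit best values of `θ` (`exists_masterOptimal`). Finally,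
finitely many first-stage vectors have finitely many values, so a small tolerance already forces
exact optimality. -/

/-! ### Theorems of the alternative for linear inequalities. -/

/-- **Farkas' lemma**: a linear functional that is nonpositive on a polyhedral cone is a conic
combination of the functionals that define the cone. -/
theorem farkas {V ι : Type*} [AddCommGroup V] [Module ℝ V] (s : Finset ι) :
    ∀ (l : ι → V →ₗ[ℝ] ℝ) (b : V →ₗ[ℝ] ℝ), (∀ z, (∀ i ∈ s, l i z ≤ 0) → b z ≤ 0) →
      ∃ c : ι → ℝ, (∀ i, 0 ≤ c i) ∧ b = ∑ i ∈ s, c i • l i := by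
  classical
  induction s using Finset.induction_on with
  | empty =>
    intro l b hb
    refine ⟨0, fun _ => le_rfl, ?_⟩
    ext z
    have h₁ := hb z (by simp)
    have h₂ := hb (-z) (by simp)
    rw [map_neg] at h₂
    simp only [Finset.sum_empty, LinearMap.zero_apply]
    linarith
  | insert k s hk ih =>
    intro l b hb
    -- Either the functional `l k` is redundant and gets weight zero, or some point violates the
    -- conclusion using `s` alone; `l k` must be positive there.
    by_cases h : ∀ z, (∀ i ∈ s, l i z ≤ 0) → b z ≤ 0
    · obtain ⟨c, hc, hbc⟩ := ih l b h
      refine ⟨Function.update c k 0, fun i => ?_, ?_⟩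
      · by_cases hi : i = k
        · simp [hi]
        · simpa [hi] using hc i
      · rw [Finset.sum_insert hk, hbc]
        simp only [Function.update_self, zero_smul, zero_add]
        refine Finset.sum_congr rfl fun i hi => ?_
        rw [Function.update_of_ne (ne_of_mem_of_not_mem hi hk)]
    · push Not at h
      obtain ⟨z₁, hz₁, hbz₁⟩ := h
      have hk₁ : 0 < l k z₁ := by
        by_contra! hle
        refine absurd (hb z₁ fun i hi => ?_) (not_le.2 hbz₁)
        rcases Finset.mem_insert.1 hi with rfl | hi
        exacts [hle, hz₁ i hi]
      obtain ⟨z₀, hz₀, hbz₀, hk₀⟩ : ∃ z₀, (∀ i ∈ s, l i z₀ ≤ 0) ∧ 0 < b z₀ ∧ l k z₀ = 1 := by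
        refine ⟨(l k z₁)⁻¹ • z₁, fun i hi => ?_, ?_, ?_⟩
        · rw [map_smul, smul_eq_mul]
          exact mul_nonpos_of_nonneg_of_nonpos (by positivity) (hz₁ i hi)
        · rw [map_smul, smul_eq_mul]
          positivity
        · rw [map_smul, smul_eq_mul, inv_mul_cancel₀ hk₁.ne']
      -- Since `l k z₀ = 1`, subtracting `l k z • z₀` projects onto the kernel of `l k`. The
      -- induction hypothesis is applied to the functionals composed with this projection.
      obtain ⟨c, hc, hbc⟩ := ih (fun i => l i - l i z₀ • l k) (b - b z₀ • l k) (by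
        intro z hz
        have key := hb (z - l k z • z₀) (fun i hi => by
          rcases Finset.mem_insert.1 hi with rfl | hi
          · simp [hk₀]
          · have := hz i hi
            simp only [LinearMap.sub_apply, LinearMap.smul_apply, smul_eq_mul] at this
            simp only [map_sub, map_smul, smul_eq_mul]
            linarith)
        simp only [map_sub, map_smul, smul_eq_mul] at key
        simp only [LinearMap.sub_apply, LinearMap.smul_apply, smul_eq_mul]
        linarith)
      have hnn : 0 ≤ b z₀ - ∑ i ∈ s, c i * l i z₀ := by
        have : ∑ i ∈ s, c i * l i z₀ ≤ 0 := Finset.sum_nonpos fun i hi =>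
          mul_nonpos_of_nonneg_of_nonpos (hc i) (hz₀ i hi)
        linarith
      refine ⟨Function.update c k (b z₀ - ∑ i ∈ s, c i * l i z₀), fun i => ?_, ?_⟩
      · by_cases hi : i = k
        · subst hi; simpa using hnn
        · simpa [hi] using hc i
      · rw [Finset.sum_insert hk, Function.update_self]
        have hs : ∑ i ∈ s, Function.update c k (b z₀ - ∑ i ∈ s, c i * l i z₀) i • l i =
            ∑ i ∈ s, c i • l i := Finset.sum_congr rfl fun i hi => by
          rw [Function.update_of_ne (ne_of_mem_of_not_mem hi hk)]
        rw [hs]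
        ext z
        have := LinearMap.congr_fun hbc z
        simp only [LinearMap.sub_apply, LinearMap.smul_apply, smul_eq_mul, LinearMap.sum_apply,
          mul_sub, Finset.sum_sub_distrib, LinearMap.add_apply, ← mul_assoc, ← Finset.sum_mul]
          at this ⊢
        linarith

/-- A finite system of linear inequalities is solvable, or some conic combination of it is
contradictory. -/
theorem exists_le_or_exists_combination {V ι : Type*} [AddCommGroup V] [Module ℝ V] [Fintype ι]
    (l : ι → V →ₗ[ℝ] ℝ) (c : ι → ℝ) :
    (∃ z, ∀ i, l i z ≤ c i) ∨
      ∃ w : ι → ℝ, (∀ i, 0 ≤ w i) ∧ (∀ z, ∑ i, w i * l i z = 0) ∧ ∑ i, w i * c i < 0 := by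
  by_cases h : ∃ z, ∀ i, l i z ≤ c i
  · exact .inl h
  · right
    push Not at h
    -- Homogenize with an extra variable `t`: a point of the cone with `t > 0` would give the
    -- solution `t⁻¹ • z`, so `t ≤ 0` on the whole cone.
    obtain ⟨w, hw, he⟩ := farkas (V := V × ℝ) Finset.univ
      (fun i => l i ∘ₗ LinearMap.fst ℝ V ℝ - c i • LinearMap.snd ℝ V ℝ)
      (LinearMap.snd ℝ V ℝ) (by
        rintro ⟨z, t⟩ hz
        by_contra! ht
        simp only [LinearMap.snd_apply] at ht
        obtain ⟨i, hi⟩ := h (t⁻¹ • z)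
        have := hz i (Finset.mem_univ i)
        simp only [LinearMap.sub_apply, LinearMap.comp_apply, LinearMap.fst_apply,
          LinearMap.smul_apply, LinearMap.snd_apply, smul_eq_mul] at this
        rw [map_smul, smul_eq_mul, inv_mul_eq_div, lt_div_iff₀ ht] at hi
        linarith)
    refine ⟨w, hw, fun z => ?_, ?_⟩
    · have := LinearMap.congr_fun he (z, 0)
      simpa [LinearMap.sum_apply] using this.symm
    · have := LinearMap.congr_fun he (0, 1)
      simp only [LinearMap.snd_apply, LinearMap.sum_apply, LinearMap.sub_apply,
        LinearMap.comp_apply, LinearMap.fst_apply, map_zero, LinearMap.smul_apply, smul_eq_mul,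
        mul_one, zero_sub, mul_neg, Finset.sum_neg_distrib] at this
      linarith

/-! ### Linear programming duality for one block. -/

namespace Block

variable (B : Block)

/-- Exchanging the order of summation: grouping the arcs by tail and by head turns potential
differences into net outflows. This is the bilinear identity behind weak duality. -/
theorem sum_mul_dualLhs (y : B.Arc → ℝ) (q : B.Dual) [DecidableEq B.Node] :
    ∑ a, y a * B.dualLhs q a =
      (∑ n, ((∑ a with B.tail a = n, y a) - ∑ a with B.head a = n, y a) * q.1 n) +
        ∑ i, (∑ a, B.f a i * y a) * q.2 i := by
  have fib : ∀ e : B.Arc → B.Node,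
      ∑ n, (∑ a with e a = n, y a) * q.1 n = ∑ a, y a * q.1 (e a) := fun e => by
    rw [← Finset.sum_fiberwise Finset.univ e]
    refine Finset.sum_congr rfl fun n _ => ?_
    rw [Finset.sum_mul]
    refine Finset.sum_congr rfl fun a ha => ?_
    rw [(Finset.mem_filter.1 ha).2]
  simp only [dualLhs, mul_add, mul_sub, sub_mul, Finset.sum_add_distrib, Finset.sum_sub_distrib,
    fib]
  congr 1
  simp only [Finset.mul_sum, Finset.sum_mul]
  rw [Finset.sum_comm]
  exact Finset.sum_congr rfl fun i _ => Finset.sum_congr rfl fun a _ => by ring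

/-- The linear constraints, in aggregated form. -/
theorem linear_iff (d : B.Node → ℝ) (y : B.Arc → ℝ) :
    B.Linear d y ↔ ∀ q : B.Dual, (∀ i, 0 ≤ q.2 i) →
      B.dualObj d q ≤ ∑ a, y a * B.dualLhs q a := by
  classical
  simp only [sum_mul_dualLhs]
  constructor
  · rintro ⟨h₁, h₂⟩ q hq
    refine add_le_add (le_of_eq ?_) ?_
    · refine Finset.sum_congr rfl fun n _ => ?_
      rw [← h₁ n]
    · exact Finset.sum_le_sum fun i _ => mul_le_mul_of_nonneg_right (h₂ i) (hq i)
  · intro h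
    constructor
    · intro n
      -- Node multipliers are free in sign, so testing with both signs turns the inequality into
      -- flow balance.
      have h₁ := h (Pi.single n 1, 0) fun _ => le_rfl
      have h₂ := h (Pi.single n (-1), 0) fun _ => le_rfl
      simp only [dualObj, Pi.zero_apply, mul_zero, Finset.sum_const_zero, add_zero,
        Pi.single_apply, mul_ite, Finset.sum_ite_eq', Finset.mem_univ, if_true, mul_one,
        mul_neg] at h₁ h₂
      refine le_antisymm ?_ ?_
      · convert neg_le_neg h₂ using 1 <;> simp
      · convert h₁ using 1
    · intro i
      have h₁ := h (0, Pi.single i 1) (fun k => by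
        by_cases hk : k = i
        · subst hk; simp
        · simp [hk])
      simpa [dualObj, Pi.single_apply] using h₁

theorem dualObj_smul (d : B.Node → ℝ) (t : ℝ) (p : B.Dual) :
    B.dualObj d (t • p) = t * B.dualObj d p := by
  simp only [dualObj, Prod.smul_fst, Prod.smul_snd, Pi.smul_apply, smul_eq_mul, mul_add,
    Finset.mul_sum]
  congr 1 <;> exact Finset.sum_congr rfl fun i _ => by ring

theorem dualObj_add (d : B.Node → ℝ) (p q : B.Dual) :
    B.dualObj d (p + q) = B.dualObj d p + B.dualObj d q := by
  simp only [dualObj, Prod.fst_add, Prod.snd_add, Pi.add_apply, mul_add,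
    Finset.sum_add_distrib]
  ring

theorem dualLhs_smul (a : B.Arc) (t : ℝ) (p : B.Dual) :
    B.dualLhs (t • p) a = t * B.dualLhs p a := by
  simp only [dualLhs, Prod.smul_fst, Prod.smul_snd, Pi.smul_apply, smul_eq_mul, mul_add, mul_sub,
    Finset.mul_sum, mul_assoc]

theorem dualLhs_add (a : B.Arc) (p q : B.Dual) :
    B.dualLhs (p + q) a = B.dualLhs p a + B.dualLhs q a := by
  simp only [dualLhs, Prod.fst_add, Prod.snd_add, Pi.add_apply, add_mul,
    Finset.sum_add_distrib]
  ring

/-- Weak duality, for arbitrary arc costs `c`. -/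
theorem dualObj_le_sum {A' : Set B.Arc} {d : B.Node → ℝ} {y : B.Arc → ℝ} {c : B.Arc → ℝ}
    {q : B.Dual} (hy : B.RelaxFeasible A' d y) (hq : ∀ i, 0 ≤ q.2 i)
    (hc : ∀ a ∈ A', B.dualLhs q a ≤ c a) : B.dualObj d q ≤ ∑ a, c a * y a := by
  refine ((B.linear_iff d y).1 hy.1 q hq).trans (Finset.sum_le_sum fun a _ => ?_)
  by_cases ha : a ∈ A'
  · rw [mul_comm]
    exact mul_le_mul_of_nonneg_right (hc a ha) (hy.2.1 a)
  · simp [hy.2.2 a ha]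

theorem dualObj_le_cost {A' : Set B.Arc} {d : B.Node → ℝ} {y : B.Arc → ℝ} {q : B.Dual}
    (hy : B.RelaxFeasible A' d y) (hq : q ∈ B.dualPoly A') : B.dualObj d q ≤ B.cost y :=
  B.dualObj_le_sum hy hq.1 hq.2

theorem IntFeasible.relaxFeasible {B : Block} {d : B.Node → ℝ} {y : B.Arc → ℝ}
    (hy : B.IntFeasible d y) : B.RelaxFeasible Set.univ d y :=
  ⟨hy.1, fun a => B.Y_nonneg a _ (hy.2 a), fun _ ha => absurd trivial ha⟩

theorem RelaxFeasible.mono {B : Block} {A₁ A₂ : Set B.Arc} (h : A₁ ⊆ A₂) {d : B.Node → ℝ}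
    {y : B.Arc → ℝ} (hy : B.RelaxFeasible A₁ d y) : B.RelaxFeasible A₂ d y :=
  ⟨hy.1, hy.2.1, fun a ha => hy.2.2 a fun h' => ha (h h')⟩

/-- Alternative for the dual system with arc costs `c` and objective value at least `v`. -/
theorem exists_dual_or_exists_primal (A' : Set B.Arc) (d : B.Node → ℝ) (c : B.Arc → ℝ) (v : ℝ) :
    (∃ p : B.Dual, (∀ i, 0 ≤ p.2 i) ∧ (∀ a ∈ A', B.dualLhs p a ≤ c a) ∧ v ≤ B.dualObj d p) ∨
    ∃ (y : B.Arc → ℝ) (t : ℝ), (∀ a, 0 ≤ y a) ∧ (∀ a, a ∉ A' → y a = 0) ∧ 0 ≤ t ∧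
      (∀ q : B.Dual, (∀ i, 0 ≤ q.2 i) → t * B.dualObj d q ≤ ∑ a, y a * B.dualLhs q a) ∧
      ∑ a, c a * y a < t * v := by
  classical
  let lhs : B.Arc → B.Dual →ₗ[ℝ] ℝ := fun a =>
    { toFun := fun p => B.dualLhs p a
      map_add' := B.dualLhs_add a
      map_smul' := fun t p => B.dualLhs_smul a t p }
  let obj : B.Dual →ₗ[ℝ] ℝ :=
    { toFun := B.dualObj d
      map_add' := B.dualObj_add d
      map_smul' := fun t p => B.dualObj_smul d t p }
  rcases exists_le_or_exists_combination (V := B.Dual) (ι := A' ⊕ B.Row ⊕ Unit)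
    (Sum.elim (fun a => lhs a) (Sum.elim
      (fun i => -(LinearMap.proj i ∘ₗ LinearMap.snd ℝ (B.Node → ℝ) (B.Row → ℝ)))
      fun _ => -obj))
    (Sum.elim (fun a => c a) (Sum.elim 0 fun _ => -v)) with ⟨p, hp⟩ | ⟨w, hw, h₀, h₁⟩
  · refine .inl ⟨p, fun i => ?_, fun a ha => hp (.inl ⟨a, ha⟩), ?_⟩
    · have := hp (.inr (.inl i))
      simpa using this
    · have := hp (.inr (.inr ()))
      simpa [obj] using this
  · right
    -- The multipliers live on the arcs of `A'` only; as a primal vector they are extended by zero.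
    have ext : ∀ e : B.Arc → ℝ,
        ∑ a, (if h : a ∈ A' then w (.inl ⟨a, h⟩) else 0) * e a =
          ∑ a : A', w (.inl a) * e a := fun e => by
      have : ∀ a, (if h : a ∈ A' then w (.inl ⟨a, h⟩) else 0) * e a =
          if h : a ∈ A' then w (.inl ⟨a, h⟩) * e a else 0 := fun a => by
        split_ifs <;> simp
      simp only [this]
      rw [Finset.sum_dite]
      simp only [Finset.sum_const_zero, add_zero]
      refine Finset.sum_bij' (fun a _ => ⟨a.1, (Finset.mem_filter.1 a.2).2⟩)
        (fun a _ => ⟨a.1, by simp⟩) ?_ ?_ ?_ ?_ ?_ <;> simp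
    refine ⟨fun a => if h : a ∈ A' then w (.inl ⟨a, h⟩) else 0, w (.inr (.inr ())), ?_, ?_,
      hw _, ?_, ?_⟩
    · intro a
      dsimp only
      split_ifs
      exacts [hw _, le_rfl]
    · intro a ha
      simp [ha]
    · intro q hq
      rw [ext]
      have := h₀ q
      simp only [Fintype.sum_sum_type, Sum.elim_inl, Sum.elim_inr, LinearMap.neg_apply,
        LinearMap.comp_apply, LinearMap.snd_apply, LinearMap.proj_apply, mul_neg,
        Finset.sum_neg_distrib, Finset.univ_unique, Finset.sum_singleton] at this
      have hnn : 0 ≤ ∑ i, w (.inr (.inl i)) * q.2 i :=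
        Finset.sum_nonneg fun i _ => mul_nonneg (hw _) (hq i)
      change _ * obj q ≤ ∑ a : A', w (.inl a) * lhs a q
      change ∑ a : A', w (.inl a) * lhs a q + (-_ + -(w (.inr (.inr ())) * obj q)) = 0 at this
      linarith
    · simp only [mul_comm (c _)]
      rw [ext]
      simp only [Fintype.sum_sum_type, Sum.elim_inl, Sum.elim_inr, Pi.zero_apply, mul_zero,
        Finset.sum_const_zero, zero_add, Finset.univ_unique, Finset.sum_singleton, mul_neg] at h₁
      change _ + -(w (.inr (.inr ())) * v) < 0 at h₁
      linarith

/-- The alternative yields a homogenized primal point; when its scale `t` is positive, dividing by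
it gives a genuine one. -/
theorem relaxFeasible_div {A' : Set B.Arc} {d : B.Node → ℝ} {y : B.Arc → ℝ} {t : ℝ} (ht : 0 < t)
    (hy : ∀ a, 0 ≤ y a) (hA : ∀ a, a ∉ A' → y a = 0)
    (h : ∀ q : B.Dual, (∀ i, 0 ≤ q.2 i) → t * B.dualObj d q ≤ ∑ a, y a * B.dualLhs q a) :
    B.RelaxFeasible A' d (fun a => y a / t) := by
  refine ⟨(B.linear_iff _ _).2 fun q hq => ?_, fun a => div_nonneg (hy a) ht.le,
    fun a ha => by simp [hA a ha]⟩
  simp only [div_mul_eq_mul_div, ← Finset.sum_div]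
  rw [le_div_iff₀ ht, mul_comm]
  exact h q hq

/-- Linear programming duality with attainment in the dual. -/
theorem exists_dualOptimal {A' : Set B.Arc} {d : B.Node → ℝ}
    (hne : ∃ y, B.RelaxFeasible A' d y)
    (hbdd : BddBelow (B.cost '' {y | B.RelaxFeasible A' d y})) :
    ∃ p, B.DualOptimal A' d p := by
  set v := sInf (B.cost '' {y | B.RelaxFeasible A' d y}) with hv
  have hle : ∀ y, B.RelaxFeasible A' d y → v ≤ B.cost y := fun y hy =>
    csInf_le hbdd ⟨y, hy, rfl⟩
  obtain ⟨y₀, hy₀⟩ := hne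
  rcases B.exists_dual_or_exists_primal A' d B.g v with ⟨p, h₁, h₂, h₃⟩ | ⟨y, t, hy, hA, ht, h, hlt⟩
  · refine ⟨p, ⟨h₁, h₂⟩, fun q hq => le_trans ?_ h₃⟩
    refine le_csInf ⟨_, y₀, hy₀, rfl⟩ ?_
    rintro _ ⟨y, hy, rfl⟩
    exact B.dualObj_le_cost hy hq
  · exfalso
    -- For `t > 0`, rescaling gives a feasible point cheaper than the infimum. For `t = 0`, `y` is a
    -- recession direction of negative cost.
    rcases ht.lt_or_eq with ht | rfl
    · have := hle _ (B.relaxFeasible_div ht hy hA h)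
      simp only [cost, ← mul_div_assoc, ← Finset.sum_div] at this
      rw [le_div_iff₀ ht] at this
      linarith
    · set δ := ∑ a, B.g a * y a with hδ
      rw [zero_mul] at hlt
      -- This step length brings the cost down to exactly `v - 1`, below the infimum.
      set r := (B.cost y₀ - v + 1) / (-δ) with hr
      have hr₀ : 0 ≤ r := div_nonneg (by linarith [hle y₀ hy₀]) (by linarith)
      have hfeas : B.RelaxFeasible A' d (fun a => y₀ a + r * y a) := by
        refine ⟨(B.linear_iff _ _).2 fun q hq => ?_,
          fun a => add_nonneg (hy₀.2.1 a) (mul_nonneg hr₀ (hy a)),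
          fun a ha => by simp [hA a ha, hy₀.2.2 a ha]⟩
        have h₁ := (B.linear_iff _ _).1 hy₀.1 q hq
        have h₂ := h q hq
        rw [zero_mul] at h₂
        simp only [add_mul, Finset.sum_add_distrib, mul_assoc, ← Finset.mul_sum]
        linarith [mul_nonneg hr₀ h₂]
      have h₁ := hle _ hfeas
      have h₂ : B.cost (fun a => y₀ a + r * y a) = B.cost y₀ + r * δ := by
        simp only [cost, hδ, Finset.mul_sum, mul_add, Finset.sum_add_distrib]
        congr 1
        exact Finset.sum_congr rfl fun a _ => by ring
      have h₃ : r * δ = -(B.cost y₀ - v + 1) := by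
        rw [hr, div_neg, neg_mul, div_mul_cancel₀ _ hlt.ne]
      linarith

/-- An infeasible restricted relaxation has an unbounded dual ray. -/
theorem exists_dualRay {A' : Set B.Arc} {d : B.Node → ℝ}
    (hne : ¬ ∃ y, B.RelaxFeasible A' d y) : ∃ r, B.DualRay A' d r := by
  rcases B.exists_dual_or_exists_primal A' d 0 1 with ⟨p, h₁, h₂, h₃⟩ | ⟨y, t, hy, hA, ht, h, hlt⟩
  · exact ⟨p, h₁, h₂, zero_lt_one.trans_le h₃⟩
  · simp only [Pi.zero_apply, zero_mul, Finset.sum_const_zero, mul_one] at hlt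
    exact absurd ⟨_, B.relaxFeasible_div hlt hy hA h⟩ hne

/-! ### Column generation. -/

theorem dualPoly_anti {A₁ A₂ : Set B.Arc} (h : A₁ ⊆ A₂) : B.dualPoly A₂ ⊆ B.dualPoly A₁ :=
  fun _ hp => ⟨hp.1, fun a ha => hp.2 a (h ha)⟩

/-- A restricted dual optimum that prices out no arc is optimal for the unrestricted dual. -/
theorem DualOptimal.univ_of_redCost_nonneg {B : Block} {A' : Set B.Arc} {d : B.Node → ℝ}
    {p : B.Dual} (hp : B.DualOptimal A' d p) (h : ∀ a, 0 ≤ B.redCost p a) :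
    B.DualOptimal Set.univ d p :=
  ⟨⟨hp.1.1, fun a _ => sub_nonneg.1 (h a)⟩,
    fun q hq => hp.2 q (B.dualPoly_anti (Set.subset_univ _) hq)⟩

/-- Priced-out arcs do not belong to the restricted arc set. -/
theorem Prices.disjoint {B : Block} {A' new : Set B.Arc} {d : B.Node → ℝ}
    (h : B.Prices A' d new) : Disjoint A' new := by
  rw [Set.disjoint_left]
  rintro a ha hnew
  rcases h with ⟨p, hp, hneg, -⟩ | ⟨r, hr, hpos, -⟩
  · exact absurd (hp.1.2 a ha) (not_le.2 (sub_neg.1 (hneg a hnew)))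
  · exact absurd (hr.2.1 a ha) (not_le.2 (hpos a hnew))

/-- A round of column generation can be carried out, and it finds new arcs unless the restricted
relaxation has a dual solution that is optimal for all arcs. -/
theorem exists_prices (A' : Set B.Arc) {d : B.Node → ℝ}
    (hne : ∃ y, B.RelaxFeasible Set.univ d y)
    (hbdd : BddBelow (B.cost '' {y | B.RelaxFeasible Set.univ d y})) :
    ∃ new, B.Prices A' d new ∧
      (new = ∅ → ∃ p, B.DualOptimal A' d p ∧ ∀ a, 0 ≤ B.redCost p a) := by
  by_cases hA : ∃ y, B.RelaxFeasible A' d y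
  · obtain ⟨p, hp⟩ := B.exists_dualOptimal hA (hbdd.mono (Set.image_mono fun y hy =>
      RelaxFeasible.mono (Set.subset_univ _) hy))
    have hempty : {a | B.redCost p a < 0} = ∅ → ∀ a, 0 ≤ B.redCost p a := fun h a =>
      not_lt.1 fun ha => (h ▸ ha : a ∈ (∅ : Set B.Arc))
    exact ⟨{a | B.redCost p a < 0}, .inl ⟨p, hp, fun a ha => ha, hempty⟩,
      fun h => ⟨p, hp, hempty h⟩⟩
  · obtain ⟨r, hr⟩ := B.exists_dualRay hA
    have hempty : {a | 0 < B.dualLhs r a} = ∅ → ∀ a, B.dualLhs r a ≤ 0 := fun h a =>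
      not_lt.1 fun ha => (h ▸ ha : a ∈ (∅ : Set B.Arc))
    refine ⟨{a | 0 < B.dualLhs r a}, .inr ⟨r, hr, fun a ha => ha, hempty⟩, fun h => ?_⟩
    -- A ray that prices out no arc would certify infeasibility of the full relaxation, which is
    -- feasible.
    obtain ⟨y, hy⟩ := hne
    have := B.dualObj_le_sum (c := 0) hy hr.1 fun a _ => hempty h a
    simp only [Pi.zero_apply, zero_mul, Finset.sum_const_zero] at this
    exact absurd this (not_le.2 hr.2.2)

end Block

/-! ### Finiteness of the first stage and second-stage values. -/

namespace TwoStage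

variable {S J K M : Type*} [Fintype S] [Fintype J] [Fintype K] [Fintype M]
variable (P : TwoStage S J K M)

/-- The standing assumptions: binary first stage, relatively complete recourse, attained
second-stage minima and bounded relaxations. -/
structure Regular : Prop where
  binary : P.X = {x | ∀ k, x k = 0 ∨ x k = 1}
  recourse : P.RelativelyCompleteRecourse
  attained : P.SecondStageAttained
  bounded : P.RelaxationBounded

/-- The set of feasible first-stage decisions. -/
def firstSet : Set (K → ℝ) := {x | P.FirstFeasible x}

/-- First-stage cost plus expected second-stage cost. -/
noncomputable def value (x : K → ℝ) : ℝ :=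
  (∑ k, P.c k * x k) + ∑ s, ∑ j, P.prob s * P.phi s j x

/-- The comparison is weighted by probability because `θ` may be incomparable in scenarios of
probability zero. -/
theorem masterCost_le_masterCost {θ θ' : S → J → ℝ} (h : ∀ s j, P.prob s * θ s j ≤ P.prob s * θ' s j)
    (x : K → ℝ) : P.masterCost x θ ≤ P.masterCost x θ' :=
  add_le_add le_rfl (Finset.sum_le_sum fun s _ => Finset.sum_le_sum fun j _ => h s j)

theorem masterCost_mono {θ θ' : S → J → ℝ} (h : ∀ s j, θ s j ≤ θ' s j) (x : K → ℝ) :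
    P.masterCost x θ ≤ P.masterCost x θ' :=
  P.masterCost_le_masterCost (fun s j => mul_le_mul_of_nonneg_left (h s j) (P.prob_nonneg s)) x

variable {P}

namespace Regular

theorem binary_of_feasible (hP : P.Regular) {x : K → ℝ} (hx : P.FirstFeasible x) (k : K) :
    x k = 0 ∨ x k = 1 := by
  have := hx.1
  rw [hP.binary] at this
  exact this k

theorem finite_firstSet (hP : P.Regular) : P.firstSet.Finite := by
  refine (Set.Finite.pi' (t := fun _ : K => ({0, 1} : Set ℝ))
    fun _ => Set.toFinite _).subset fun x hx k => ?_
  simpa using hP.binary_of_feasible hx k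

theorem exists_relaxFeasible (hP : P.Regular) {x : K → ℝ} (hx : P.FirstFeasible x) (s : S) (j : J) :
    ∃ y, (P.blk s j).RelaxFeasible Set.univ (P.supply s j x) y :=
  (hP.recourse x hx s j).imp fun _ hy => hy.relaxFeasible

theorem exists_intOptimal (hP : P.Regular) {x : K → ℝ} (hx : P.FirstFeasible x) (s : S) (j : J) :
    ∃ y, (P.blk s j).IntOptimal (P.supply s j x) y :=
  hP.attained x hx s j (hP.recourse x hx s j)

end Regular

theorem phi_eq_cost {s : S} {j : J} {x : K → ℝ} {y : (P.blk s j).Arc → ℝ}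
    (hy : (P.blk s j).IntOptimal (P.supply s j x) y) : P.phi s j x = (P.blk s j).cost y :=
  IsLeast.csInf_eq ⟨⟨y, hy.1, rfl⟩, by rintro _ ⟨y', hy', rfl⟩; exact hy.2 y' hy'⟩

/-- A block sees `x` only through the supplies of its own cell. This is why an L-shaped cut may
measure distance on that cell alone. -/
theorem phi_congr {s : S} {j : J} {x w : K → ℝ} (h : ∀ k ∈ P.cell j, x k = w k) :
    P.phi s j x = P.phi s j w := by
  have : P.supply s j x = P.supply s j w := by
    funext n
    exact Finset.sum_congr rfl fun k hk => by rw [h k hk]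
  rw [phi, phi, this]

theorem dist_self (j : J) (x : K → ℝ) : P.dist j x x = 0 := by
  unfold dist
  rw [Finset.sum_eq_zero, Finset.sum_eq_zero, add_zero]
  · exact fun k hk => (Finset.mem_filter.1 hk).2
  · exact fun k hk => by rw [(Finset.mem_filter.1 hk).2, sub_self]

theorem totalCost_eq_value {x : K → ℝ} {y : P.Second}
    (hy : ∀ s j, (P.blk s j).IntOptimal (P.supply s j x) (y s j)) :
    P.totalCost x y = P.value x := by
  simp only [totalCost, value, phi_eq_cost (hy _ _)]

/-! ### Validity of the cuts. -/

namespace Regular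

theorem phi_le_cost (hP : P.Regular) {s : S} {j : J} {x : K → ℝ} (hx : P.FirstFeasible x)
    {y : (P.blk s j).Arc → ℝ} (hy : (P.blk s j).IntFeasible (P.supply s j x) y) :
    P.phi s j x ≤ (P.blk s j).cost y := by
  obtain ⟨y', hy'⟩ := hP.exists_intOptimal hx s j
  rw [phi_eq_cost hy']
  exact hy'.2 y hy

theorem value_le_totalCost (hP : P.Regular) {x : K → ℝ} {y : P.Second} (h : P.Feasible x y) :
    P.value x ≤ P.totalCost x y :=
  P.masterCost_mono (θ := fun s j => P.phi s j x) (θ' := fun s j => (P.blk s j).cost (y s j))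
    (fun s j => hP.phi_le_cost h.1 (h.2 s j)) x

/-- Validity of Benders cuts. -/
theorem dualObj_le_phi (hP : P.Regular) {s : S} {j : J} {x : K → ℝ} (hx : P.FirstFeasible x)
    {p : (P.blk s j).Dual} (hp : p ∈ (P.blk s j).dualPoly Set.univ) :
    (P.blk s j).dualObj (P.supply s j x) p ≤ P.phi s j x := by
  obtain ⟨y, hy⟩ := hP.exists_intOptimal hx s j
  rw [phi_eq_cost hy]
  exact (P.blk s j).dualObj_le_cost hy.1.relaxFeasible hp

/-- On binary vectors every summand of the distance is nonnegative, and an index where they differ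
contributes exactly one. -/
theorem one_le_dist (hP : P.Regular) {j : J} {w x : K → ℝ} (hw : P.FirstFeasible w)
    (hx : P.FirstFeasible x) {k : K} (hk : k ∈ P.cell j) (hne : x k ≠ w k) :
    1 ≤ P.dist j w x := by
  have h₁ : ∀ i ∈ {k ∈ P.cell j | w k = 1}, 0 ≤ 1 - x i := fun i _ => by
    rcases hP.binary_of_feasible hx i with h | h <;> simp [h]
  have h₂ : ∀ i ∈ {k ∈ P.cell j | w k = 0}, 0 ≤ x i := fun i _ => by
    rcases hP.binary_of_feasible hx i with h | h <;> simp [h]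
  unfold dist
  rcases hP.binary_of_feasible hw k with h | h
  · have hx1 : x k = 1 := (hP.binary_of_feasible hx k).resolve_left fun h' => hne (h'.trans h.symm)
    have := Finset.single_le_sum h₂ (Finset.mem_filter.2 ⟨hk, h⟩)
    linarith [Finset.sum_nonneg h₁]
  · have hx0 : x k = 0 := (hP.binary_of_feasible hx k).resolve_right fun h' => hne (h'.trans h.symm)
    have := Finset.single_le_sum h₁ (Finset.mem_filter.2 ⟨hk, h⟩)
    linarith [Finset.sum_nonneg h₂]

/-- Validity of integer L-shaped cuts. -/
theorem lShaped_le_phi (hP : P.Regular) {Φ : S → J → ℝ} (hΦ : P.IsLowerBound Φ) (s : S) (j : J)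
    {w x : K → ℝ} (hw : P.FirstFeasible w) (hx : P.FirstFeasible x) :
    Φ s j + (P.phi s j w - Φ s j) * (1 - P.dist j w x) ≤ P.phi s j x := by
  by_cases h : ∀ k ∈ P.cell j, x k = w k
  · have hd : P.dist j w x = P.dist j w w := by
      unfold dist
      congr 1 <;> refine Finset.sum_congr rfl fun k hk => ?_ <;>
        rw [h k (Finset.mem_filter.1 hk).1]
    rw [hd, dist_self, phi_congr h]
    linarith
  · push Not at h
    obtain ⟨k, hk, hne⟩ := h
    have h₁ := hP.one_le_dist hw hx hk hne
    have h₂ := mul_nonpos_of_nonneg_of_nonpos (sub_nonneg.2 (hΦ w hw s j))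
      (sub_nonpos.2 h₁)
    linarith [hΦ x hx s j]

/-- No cut ever removes a true second-stage value, so the master problem remains a relaxation. -/
theorem masterFeasible_phi (hP : P.Regular) {Φ : S → J → ℝ} (hΦ : P.IsLowerBound Φ)
    {U : P.BendersCuts} {W : Set (K → ℝ)}
    (hU : ∀ s j, U s j ⊆ (P.blk s j).dualPoly Set.univ) (hW : W ⊆ P.firstSet)
    {x : K → ℝ} (hx : P.FirstFeasible x) :
    P.MasterFeasible Φ U W x fun s j => P.phi s j x :=
  ⟨hx, fun s j _ hp => hP.dualObj_le_phi hx (hU s j hp),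
    fun s j _ hw => hP.lShaped_le_phi hΦ s j (hW hw) hx⟩

end Regular

/-! ### Attainment in the master problem. -/

/-- The right-hand sides of the cuts for `θ s j` at `x`. -/
def cutValues (Φ : S → J → ℝ) (U : P.BendersCuts) (W : Set (K → ℝ)) (x : K → ℝ) (s : S) (j : J) :
    Set ℝ :=
  (fun p => (P.blk s j).dualObj (P.supply s j x) p) '' U s j ∪
    (fun w => Φ s j + (P.phi s j w - Φ s j) * (1 - P.dist j w x)) '' W

theorem masterFeasible_iff {Φ : S → J → ℝ} {U : P.BendersCuts} {W : Set (K → ℝ)} {x : K → ℝ}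
    {θ : S → J → ℝ} : P.MasterFeasible Φ U W x θ ↔
      P.FirstFeasible x ∧ ∀ s j, ∀ v ∈ P.cutValues Φ U W x s j, v ≤ θ s j := by
  constructor
  · rintro ⟨hx, h₁, h₂⟩
    refine ⟨hx, fun s j v hv => ?_⟩
    rcases hv with ⟨p, hp, rfl⟩ | ⟨w, hw, rfl⟩
    exacts [h₁ s j p hp, h₂ s j w hw]
  · rintro ⟨hx, h⟩
    exact ⟨hx, fun s j p hp => h s j _ (.inl ⟨p, hp, rfl⟩),
      fun s j w hw => h s j _ (.inr ⟨w, hw, rfl⟩)⟩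

theorem MasterFeasible.anti {Φ : S → J → ℝ} {U U' : P.BendersCuts} {W W' : Set (K → ℝ)}
    (hU : ∀ s j, U s j ⊆ U' s j) (hW : W ⊆ W') {x : K → ℝ} {θ : S → J → ℝ}
    (h : P.MasterFeasible Φ U' W' x θ) : P.MasterFeasible Φ U W x θ :=
  ⟨h.1, fun s j p hp => h.2.1 s j p (hU s j hp), fun s j w hw => h.2.2 s j w (hW hw)⟩

/-- The master objective is bounded below. -/
def MasterBounded (P : TwoStage S J K M) (Φ : S → J → ℝ) (U : P.BendersCuts)
    (W : Set (K → ℝ)) : Prop :=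
  BddBelow {v | ∃ x θ, P.MasterFeasible Φ U W x θ ∧ v = P.masterCost x θ}

theorem MasterBounded.mono {Φ : S → J → ℝ} {U U' : P.BendersCuts} {W W' : Set (K → ℝ)}
    (hU : ∀ s j, U s j ⊆ U' s j) (hW : W ⊆ W') (h : P.MasterBounded Φ U W) :
    P.MasterBounded Φ U' W' :=
  BddBelow.mono (by rintro v ⟨x, θ, hf, rfl⟩; exact ⟨x, θ, hf.anti hU hW, rfl⟩) h

/-- For a fixed first-stage decision, the best choice of `θ` in a bounded master problem. -/
theorem MasterBounded.exists_best {Φ : S → J → ℝ} {U : P.BendersCuts} {W : Set (K → ℝ)}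
    (h : P.MasterBounded Φ U W) (hU : ∀ s j, (U s j).Finite) (hW : W.Finite) {x : K → ℝ}
    (hx : P.FirstFeasible x) :
    ∃ θ, P.MasterFeasible Φ U W x θ ∧
      ∀ θ', P.MasterFeasible Φ U W x θ' → P.masterCost x θ ≤ P.masterCost x θ' := by
  classical
  have hfin : ∀ s j, (P.cutValues Φ U W x s j).Finite := fun s j =>
    ((hU s j).image _).union (hW.image _)
  -- The best `θ` is the largest cut value. Without cuts `sSup` gives the default zero, harmless
  -- since the scenario then has probability zero.
  have hfeas : P.MasterFeasible Φ U W x fun s j => sSup (P.cutValues Φ U W x s j) :=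
    masterFeasible_iff.2 ⟨hx, fun s j v hv => le_csSup (hfin s j).bddAbove hv⟩
  have hprob : ∀ s j, P.cutValues Φ U W x s j = ∅ → P.prob s = 0 := by
    intro s j he
    by_contra hne
    have hpos : 0 < P.prob s := lt_of_le_of_ne (P.prob_nonneg s) (Ne.symm hne)
    obtain ⟨m, hm⟩ := h
    set θ : S → J → ℝ := fun s j => sSup (P.cutValues Φ U W x s j)
    -- Lowering an unconstrained `θ s j` by this amount brings the cost to `m - 1`, below the lower
    -- bound `m`.
    set r := (P.masterCost x θ - m + 1) / P.prob s with hr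
    have hf : P.MasterFeasible Φ U W x
        (fun s' j' => θ s' j' - if s' = s ∧ j' = j then r else 0) := by
      rw [masterFeasible_iff] at hfeas ⊢
      refine ⟨hx, fun s' j' v hv => ?_⟩
      by_cases hsj : s' = s ∧ j' = j
      · obtain ⟨rfl, rfl⟩ := hsj
        simp [he] at hv
      · simpa [hsj] using hfeas.2 s' j' v hv
    have h₁ := hm ⟨x, _, hf, rfl⟩
    have h₂ : P.masterCost x (fun s' j' => θ s' j' - if s' = s ∧ j' = j then r else 0) =
        P.masterCost x θ - P.prob s * r := by
      simp only [masterCost, mul_sub, Finset.sum_sub_distrib, mul_ite, mul_zero, ite_and]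
      simp [Finset.sum_ite_eq', add_sub_assoc]
    rw [h₂, hr, mul_div_cancel₀ _ hpos.ne'] at h₁
    linarith
  refine ⟨_, hfeas, fun θ' hθ' => P.masterCost_le_masterCost (fun s j => ?_) x⟩
  rcases (P.cutValues Φ U W x s j).eq_empty_or_nonempty with he | hne
  · simp [hprob s j he]
  · exact mul_le_mul_of_nonneg_left (csSup_le hne fun v hv => (masterFeasible_iff.1 hθ').2 s j v hv)
      (P.prob_nonneg s)

/-- A feasible and bounded master problem has an optimal solution. -/
theorem MasterBounded.exists_masterOptimal (hP : P.Regular) {Φ : S → J → ℝ}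
    {U : P.BendersCuts} {W : Set (K → ℝ)} (h : P.MasterBounded Φ U W)
    (hU : ∀ s j, (U s j).Finite) (hW : W.Finite) (hne : P.firstSet.Nonempty) :
    ∃ x θ, P.MasterOptimal Φ U W x θ := by
  classical
  have hb : ∀ x : K → ℝ, ∃ θ, P.FirstFeasible x → (P.MasterFeasible Φ U W x θ ∧
      ∀ θ', P.MasterFeasible Φ U W x θ' → P.masterCost x θ ≤ P.masterCost x θ') := fun x => by
    by_cases hx : P.FirstFeasible x
    · exact (h.exists_best hU hW hx).imp fun _ hθ _ => hθ
    · exact ⟨0, fun hx' => absurd hx' hx⟩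
  choose θ hθ using hb
  obtain ⟨x, hx, hmin⟩ := Set.exists_min_image P.firstSet (fun x => P.masterCost x (θ x))
    hP.finite_firstSet hne
  exact ⟨x, θ x, (hθ x hx).1, fun x' θ' h' =>
    (hmin x' h'.1).trans ((hθ x' h'.1).2 θ' h')⟩

/-! ### Invariants -/

/-- Properties of the cuts that all iterations preserve. -/
structure GoodCuts (P : TwoStage S J K M) (Φ : S → J → ℝ) (U : P.BendersCuts)
    (W : Set (K → ℝ)) : Prop where
  finite : ∀ s j, (U s j).Finite
  subset : ∀ s j, U s j ⊆ (P.blk s j).dualPoly Set.univ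
  visited : W ⊆ P.firstSet
  bounded : P.MasterBounded Φ U W

/-- The invariant of the algorithm. -/
def State.Inv (Φ : S → J → ℝ) (ε : ℝ) : P.State → Prop
  | .master _ U W => P.GoodCuts Φ U W
  | .sub _ U W x θ => P.GoodCuts Φ U W ∧ P.MasterOptimal Φ U W x θ
  | .second _ U W x θ => P.GoodCuts Φ U W ∧ P.MasterOptimal Φ U W x θ
  | .infeasible => ∀ x y, ¬ P.Feasible x y
  | .done x y => P.FirstFeasible x ∧
      (∀ s j, (P.blk s j).IntOptimal (P.supply s j x) (y s j)) ∧
      ∀ x', P.FirstFeasible x' → P.value x ≤ P.value x' + ε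

theorem Initial.inv {Φ : S → J → ℝ} {ε : ℝ} {σ : P.State} (h : P.Initial Φ σ) :
    σ.Inv Φ ε := by
  obtain ⟨A', U, rfl, hU, hb⟩ := h
  exact ⟨fun s j => (hU s j).1, fun s j => (hU s j).2, Set.empty_subset _, hb⟩

theorem Step.inv (hP : P.Regular) {Φ : S → J → ℝ} (hΦ : P.IsLowerBound Φ) {ε : ℝ}
    {σ τ : P.State} (hσ : σ.Inv Φ ε) (h : P.Step Φ ε σ τ) : τ.Inv Φ ε := by
  cases h with
  | masterInfeasible hinf =>
    intro x y hxy
    exact hinf _ _ (hP.masterFeasible_phi hΦ hσ.subset hσ.visited hxy.1)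
  | masterSolve hopt => exact ⟨hσ, hopt⟩
  | price hprice hnew => exact hσ
  | benders hp hviol =>
    obtain ⟨hg, -⟩ := hσ
    refine ⟨fun s j => (hg.finite s j).union (Set.finite_singleton _),
      fun s j => Set.union_subset (hg.subset s j) (Set.singleton_subset_iff.2 ?_), hg.visited,
      hg.bounded.mono (fun s j => Set.subset_union_left) subset_rfl⟩
    exact ((hp s j).1.univ_of_redCost_nonneg (hp s j).2).1
  | bendersConverged hp hok => exact hσ
  | @finish A' U W x θ y hy hgap =>
    obtain ⟨hg, hopt⟩ := hσ
    refine ⟨hopt.1.1, hy, fun x' hx' => ?_⟩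
    have h₁ : P.masterCost x θ ≤ P.value x' :=
      hopt.2 _ _ (hP.masterFeasible_phi hΦ hg.subset hg.visited hx')
    have h₂ : P.value x - P.masterCost x θ ≤ ε := hgap
    linarith
  | lShaped hgap =>
    obtain ⟨hg, hopt⟩ := hσ
    exact ⟨hg.finite, hg.subset,
      Set.union_subset hg.visited (Set.singleton_subset_iff.2 hopt.1.1),
      hg.bounded.mono (fun s j => subset_rfl) Set.subset_union_left⟩

theorem IsRun.inv (hP : P.Regular) {Φ : S → J → ℝ} (hΦ : P.IsLowerBound Φ) {ε : ℝ}
    {σ : ℕ → P.State} {n : ℕ} (h : P.IsRun Φ ε σ n) : ∀ i ≤ n, (σ i).Inv Φ ε := by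
  intro i
  induction i with
  | zero => exact fun _ => h.1.inv
  | succ i ih => exact fun hi => (h.2 i hi).inv hP hΦ (ih (Nat.le_of_succ_le hi))

/-! ### Termination -/

/-- First-stage decisions at which the Benders cuts are not yet exact. -/
def inexact (U : P.BendersCuts) : Set (K → ℝ) :=
  {x | P.FirstFeasible x ∧ ¬ ∃ p : ∀ s j, (P.blk s j).Dual, ∀ s j, p s j ∈ U s j ∧
    (P.blk s j).DualOptimal Set.univ (P.supply s j x) (p s j)}

/-- The number of arcs outside the restricted arc sets. -/
noncomputable def missing (A' : P.ArcSets) : ℕ := ∑ s, ∑ j, (A' s j)ᶜ.ncard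

/-- The number of iterations that remain because of missing cuts and arcs. -/
noncomputable def remaining (A' : P.ArcSets) (U : P.BendersCuts) (W : Set (K → ℝ)) : ℕ :=
  4 * (P.inexact U).ncard + 4 * (P.firstSet \ W).ncard + missing A'

/-- A bound on the number of steps that can follow a state. -/
noncomputable def State.potential : P.State → ℕ
  | .master A' U W => P.remaining A' U W + 3
  | .sub A' U W _ _ => P.remaining A' U W + 2
  | .second A' U W _ _ => P.remaining A' U W + 1
  | .infeasible => 0
  | .done _ _ => 0

theorem missing_union_lt {A' new : P.ArcSets} (hd : ∀ s j, Disjoint (A' s j) (new s j))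
    (hne : ∃ s j, (new s j).Nonempty) :
    P.missing (fun s j => A' s j ∪ new s j) < P.missing A' := by
  have hle : ∀ s j, (A' s j ∪ new s j)ᶜ.ncard ≤ (A' s j)ᶜ.ncard := fun s j =>
    Set.ncard_le_ncard (Set.compl_subset_compl.2 Set.subset_union_left)
  obtain ⟨s, j, a, ha⟩ := hne
  refine Finset.sum_lt_sum (fun s _ => Finset.sum_le_sum fun j _ => hle s j)
    ⟨s, Finset.mem_univ s, Finset.sum_lt_sum (fun j _ => hle s j) ⟨j, Finset.mem_univ j, ?_⟩⟩
  refine Set.ncard_lt_ncard ((Set.ssubset_iff_of_subset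
    (Set.compl_subset_compl.2 Set.subset_union_left)).2 ⟨a, ?_, fun h => h (.inr ha)⟩)
  exact fun h => Set.disjoint_left.1 (hd s j) h ha

/-- Moving forward within an iteration lowers the phase offset, and pricing lowers `missing`. A
return to the master problem raises the offset by at most two, which the weight 4 of a lost inexact
or unvisited point outweighs. -/
theorem Step.potential_lt (hP : P.Regular) {Φ : S → J → ℝ} {ε : ℝ} (hε : 0 ≤ ε)
    {σ τ : P.State} (hσ : σ.Inv Φ ε) (h : P.Step Φ ε σ τ) : τ.potential < σ.potential := by
  have hfin := hP.finite_firstSet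
  cases h with
  | masterInfeasible hinf => simp [State.potential]
  | masterSolve hopt => simp [State.potential]
  | price hprice hnew =>
    have := missing_union_lt (fun s j => (hprice s j).disjoint) hnew
    simp only [State.potential, remaining]
    omega
  | @benders A' U W x θ p hp hviol =>
    obtain ⟨hg, hopt⟩ := hσ
    have hp' := fun s j => (hp s j).1.univ_of_redCost_nonneg (hp s j).2
    have : (P.inexact fun s j => U s j ∪ {p s j}).ncard < (P.inexact U).ncard := by
      refine Set.ncard_lt_ncard ((Set.ssubset_iff_of_subset ?_).2 ⟨x, ⟨hopt.1.1, ?_⟩, ?_⟩)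
        (hfin.subset fun z hz => hz.1)
      · rintro z ⟨hz, hn⟩
        exact ⟨hz, fun ⟨q, hq⟩ => hn ⟨q, fun s j => ⟨.inl (hq s j).1, (hq s j).2⟩⟩⟩
      -- If optimal duals `q` for `x` were already stored, their cuts would force `θ` above the dual
      -- optimum in every block, against the violation.
      · rintro ⟨q, hq⟩
        obtain ⟨s, j, hlt⟩ := hviol
        have h₁ := hopt.1.2.1 s j _ (hq s j).1
        have h₂ := (hq s j).2.2 _ (hp' s j).1
        linarith
      · rintro ⟨-, hn⟩
        exact hn ⟨p, fun s j => ⟨.inr rfl, hp' s j⟩⟩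
    simp only [State.potential, remaining]
    omega
  | bendersConverged hp hok => simp [State.potential]
  | finish hy hgap => simp [State.potential]
  | @lShaped A' U W x θ hgap =>
    obtain ⟨hg, hopt⟩ := hσ
    -- At a visited point the distance is zero, so the cuts give `θ` at least the true costs and the
    -- gap would not exceed zero.
    have hx : x ∉ W := fun hx => by
      have : P.value x ≤ P.masterCost x θ := P.masterCost_mono (θ := fun s j => P.phi s j x)
        (fun s j => by
          have := hopt.1.2.2 s j x hx
          rw [dist_self] at this
          linarith) x
      have h₂ : ε < P.value x - P.masterCost x θ := hgap
      linarith
    have : (P.firstSet \ (W ∪ {x})).ncard < (P.firstSet \ W).ncard := by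
      refine Set.ncard_lt_ncard ((Set.ssubset_iff_of_subset
        (Set.sdiff_subset_sdiff_right Set.subset_union_left)).2
          ⟨x, ⟨hopt.1.1, hx⟩, fun h => h.2 (.inr rfl)⟩) (hfin.subset Set.sdiff_subset)
    simp only [State.potential, remaining]
    omega

theorem Initial.potential_le (hP : P.Regular) {Φ : S → J → ℝ} {σ : P.State}
    (h : P.Initial Φ σ) :
    σ.potential ≤ 8 * P.firstSet.ncard + (P.missing fun _ _ => ∅) + 3 := by
  obtain ⟨A', U, rfl, -, -⟩ := h
  have h₁ : (P.inexact U).ncard ≤ P.firstSet.ncard :=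
    Set.ncard_le_ncard (fun z hz => hz.1) hP.finite_firstSet
  have h₂ : (P.firstSet \ ∅).ncard ≤ P.firstSet.ncard :=
    Set.ncard_le_ncard Set.sdiff_subset hP.finite_firstSet
  have h₃ : P.missing A' ≤ P.missing fun _ _ => ∅ :=
    Finset.sum_le_sum fun s _ => Finset.sum_le_sum fun j _ =>
      Set.ncard_le_ncard (Set.compl_subset_compl.2 (Set.empty_subset _))
  simp only [State.potential, remaining]
  omega

theorem IsRun.potential_add_le (hP : P.Regular) {Φ : S → J → ℝ} (hΦ : P.IsLowerBound Φ) {ε : ℝ}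
    (hε : 0 ≤ ε) {σ : ℕ → P.State} {n : ℕ} (h : P.IsRun Φ ε σ n) :
    ∀ i ≤ n, (σ i).potential + i ≤ (σ 0).potential := by
  intro i
  induction i with
  | zero => simp
  | succ i ih =>
    intro hi
    have h₁ := (h.2 i hi).potential_lt hP hε (h.inv hP hΦ i (Nat.le_of_succ_le hi))
    have h₂ := ih (Nat.le_of_succ_le hi)
    omega

/-! ### Progress and optimality -/

theorem State.Inv.exists_step (hP : P.Regular) {Φ : S → J → ℝ} {ε : ℝ} {σ : P.State}
    (hσ : σ.Inv Φ ε) (hs : ¬ σ.Stopped) : ∃ τ, P.Step Φ ε σ τ := by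
  cases σ with
  | master A' U W =>
    rcases P.firstSet.eq_empty_or_nonempty with he | hne
    · exact ⟨_, .masterInfeasible fun x θ h => (he ▸ h.1 : x ∈ (∅ : Set (K → ℝ)))⟩
    · obtain ⟨x, θ, h⟩ := hσ.bounded.exists_masterOptimal hP hσ.finite
        (hP.finite_firstSet.subset hσ.visited) hne
      exact ⟨_, .masterSolve h⟩
  | sub A' U W x θ =>
    obtain ⟨hg, hopt⟩ := hσ
    choose new hnew hp using fun s j => (P.blk s j).exists_prices (A' s j)
      (hP.exists_relaxFeasible hopt.1.1 s j) (hP.bounded x hopt.1.1 s j)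
    by_cases hne : ∃ s j, (new s j).Nonempty
    · exact ⟨_, .price hnew hne⟩
    · push Not at hne
      choose p hp using fun s j => hp s j (hne s j)
      by_cases hv : ∃ s j, θ s j < (P.blk s j).dualObj (P.supply s j x) (p s j)
      · exact ⟨_, .benders hp hv⟩
      · push Not at hv
        exact ⟨_, .bendersConverged hp hv⟩
  | second A' U W x θ =>
    obtain ⟨hg, hopt⟩ := hσ
    rcases le_or_gt (P.gap x θ) ε with h | h
    · choose y hy using hP.exists_intOptimal hopt.1.1
      exact ⟨_, .finish hy h⟩
    · exact ⟨_, .lShaped h⟩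
  | infeasible => exact absurd trivial hs
  | done x y => exact absurd trivial hs

theorem Regular.exists_initial (hP : P.Regular) (Φ : S → J → ℝ) : ∃ σ, P.Initial Φ σ := by
  rcases P.firstSet.eq_empty_or_nonempty with he | ⟨x₀, hx₀⟩
  · refine ⟨_, fun _ _ => ∅, fun _ _ => ∅, rfl, fun s j => ⟨Set.finite_empty, Set.empty_subset _⟩,
      0, ?_⟩
    rintro _ ⟨x, θ, h, -⟩
    exact absurd (he ▸ h.1 : x ∈ (∅ : Set (K → ℝ))) id
  · choose p hp using fun s j => (P.blk s j).exists_dualOptimal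
      (hP.exists_relaxFeasible hx₀ s j) (hP.bounded x₀ hx₀ s j)
    refine ⟨_, fun _ _ => ∅, fun s j => {p s j}, rfl,
      fun s j => ⟨Set.finite_singleton _, Set.singleton_subset_iff.2 (hp s j).1⟩, ?_⟩
    -- One dual point per block bounds every `θ s j` from below by a function of `x`, and there are
    -- finitely many `x`.
    obtain ⟨m, hm⟩ := (hP.finite_firstSet.image fun x => P.masterCost x
      fun s j => (P.blk s j).dualObj (P.supply s j x) (p s j)).bddBelow
    refine ⟨m, ?_⟩
    rintro _ ⟨x, θ, h, rfl⟩
    exact (hm ⟨x, h.1, rfl⟩).trans (P.masterCost_mono (fun s j => h.2.1 s j _ rfl) x)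

/-- Distinct values of first-stage decisions are separated. -/
theorem Regular.exists_gap (hP : P.Regular) :
    ∃ ε₀ : ℝ, 0 < ε₀ ∧ ∀ x x', P.FirstFeasible x → P.FirstFeasible x' →
      P.value x < P.value x' + ε₀ → P.value x ≤ P.value x' := by
  have hD : (((fun q : (K → ℝ) × (K → ℝ) => P.value q.1 - P.value q.2) ''
      (P.firstSet ×ˢ P.firstSet)) ∩ Set.Ioi 0).Finite :=
    ((hP.finite_firstSet.prod hP.finite_firstSet).image _).inter_of_left _
  rcases Set.eq_empty_or_nonempty (((fun q : (K → ℝ) × (K → ℝ) => P.value q.1 - P.value q.2) ''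
      (P.firstSet ×ˢ P.firstSet)) ∩ Set.Ioi 0) with he | hne
  · refine ⟨1, one_pos, fun x x' hx hx' _ => ?_⟩
    by_contra! hlt
    exact (Set.eq_empty_iff_forall_notMem.1 he) _ ⟨⟨(x, x'), ⟨hx, hx'⟩, rfl⟩, sub_pos.2 hlt⟩
  -- The threshold is the smallest positive difference of two values.
  · obtain ⟨δ, hδ, hmin⟩ := Set.exists_min_image _ id hD hne
    refine ⟨δ, hδ.2, fun x x' hx hx' h => ?_⟩
    by_contra! hlt
    have : δ ≤ P.value x - P.value x' :=
      hmin _ ⟨⟨(x, x'), ⟨hx, hx'⟩, rfl⟩, sub_pos.2 hlt⟩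
    linarith

end TwoStage

/-- Double decomposition with integer L-shaped cuts, for binary first-stage variables and relatively
complete recourse: the algorithm can be started, the number of steps of all executions is bounded, an execution that has not
stopped can be continued, `infeasible` is reported only if the two-stage problem is infeasible, the
returned pair is feasible and optimal up to the tolerance `ε ≥ 0`, and it is optimal if `ε` is
zero or small enough. -/
theorem theorem2 {S J K M : Type*} [Fintype S] [Fintype J] [Fintype K] [Fintype M]
    (P : TwoStage S J K M)
    (hbin : P.X = {x | ∀ k, x k = 0 ∨ x k = 1})
    (hrcr : P.RelativelyCompleteRecourse)
    (hatt : P.SecondStageAttained)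
    (hbdd : P.RelaxationBounded)
    (Φ : S → J → ℝ) (hΦ : P.IsLowerBound Φ) :
    (∃ σ₀ : P.State, P.Initial Φ σ₀) ∧
    (∃ N : ℕ, ∀ ε : ℝ, 0 ≤ ε → ∀ (σ : ℕ → P.State) (n : ℕ), P.IsRun Φ ε σ n → n ≤ N) ∧
    (∀ ε : ℝ, 0 ≤ ε → ∀ (σ : ℕ → P.State) (n : ℕ), P.IsRun Φ ε σ n →
      (¬ (σ n).Stopped → ∃ τ, P.Step Φ ε (σ n) τ) ∧
      (σ n = .infeasible → ∀ x y, ¬ P.Feasible x y) ∧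
      (∀ x y, σ n = .done x y → P.Feasible x y ∧
        ∀ x' y', P.Feasible x' y' → P.totalCost x y ≤ P.totalCost x' y' + ε)) ∧
    (∃ ε₀ : ℝ, 0 < ε₀ ∧ ∀ ε : ℝ, 0 ≤ ε → ε < ε₀ →
      ∀ (σ : ℕ → P.State) (n : ℕ), P.IsRun Φ ε σ n →
        ∀ x y, σ n = .done x y → P.Optimal x y) := by
  have hP : P.Regular := ⟨hbin, hrcr, hatt, hbdd⟩
  have hdone : ∀ {ε : ℝ} {σ : ℕ → P.State} {n : ℕ} {x y}, P.IsRun Φ ε σ n → σ n = .done x y →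
      (P.Feasible x y ∧ P.totalCost x y = P.value x) ∧
        ∀ x', P.FirstFeasible x' → P.value x ≤ P.value x' + ε := by
    intro ε σ n x y hrun hn
    have hinv := hrun.inv hP hΦ n le_rfl
    rw [hn] at hinv
    obtain ⟨hx, hy, hle⟩ := hinv
    exact ⟨⟨⟨hx, fun s j => (hy s j).1⟩, TwoStage.totalCost_eq_value hy⟩, hle⟩
  refine ⟨hP.exists_initial Φ, ⟨8 * P.firstSet.ncard + (P.missing fun _ _ => ∅) + 3,
    fun ε hε σ n hrun => ?_⟩, fun ε hε σ n hrun => ⟨?_, ?_, ?_⟩, ?_⟩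
  · have h₁ := hrun.potential_add_le hP hΦ hε n le_rfl
    exact ((Nat.le_add_left _ _).trans h₁).trans (hrun.1.potential_le hP)
  · exact (hrun.inv hP hΦ n le_rfl).exists_step hP
  · intro hn
    have hinv := hrun.inv hP hΦ n le_rfl
    rwa [hn] at hinv
  · intro x y hn
    obtain ⟨⟨hf, he⟩, hle⟩ := hdone hrun hn
    refine ⟨hf, fun x' y' h' => ?_⟩
    linarith [hle x' h'.1, hP.value_le_totalCost h']
  · obtain ⟨ε₀, hpos, hgap⟩ := hP.exists_gap
    refine ⟨ε₀, hpos, fun ε hε hlt σ n hrun x y hn => ?_⟩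
    obtain ⟨⟨hf, he⟩, hle⟩ := hdone hrun hn
    refine ⟨hf, fun x' y' h' => ?_⟩
    have := hgap x x' hf.1 h'.1 (by linarith [hle x' h'.1])
    linarith [hP.value_le_totalCost h']
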